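/- Let $S=\{x\in\mathbb R^3:|x|=1\}$ with surface measure $dS$, let $\mathcal E_1=L^2(S,dS)$ (complex valued functions), and use spherical coordinates $x_1=\sin\theta\cos\varphi$, $x_2=\sin\theta\sin\varphi$, $x_3=\cos\theta$ with $0\le\theta\le\pi$, $\varphi\in\mathbb R$. For $k=1,2,3$ let $R_k(\varphi)$ be the rotation of $\mathbb R^3$ by the angle $\varphi$ in the positive direction around the $k$-th coordinate axis, let $(\hat R_k(\varphi)\psi)(x)=\psi(R_k(\varphi)x)$ for $\psi\in\mathcal E_1$, and let $H_k=-i\,\frac{d}{d\varphi}\big|_{\varphi=0}\hat R_k(\varphi)$, the unbounded operator in $\mathcal E_1$ whose domain consists of all $\psi$ for which the derivative exists in the norm of $\mathcal E_1$. Let $H^2=H_1^2+H_2^2+H_3^2$ with its natural domain $\{\psi:\ \psi\in D(H_k),\ H_k\psi\in D(H_k),\ k=1,2,3\}$. Then there are smooth functions $Y_l^m:S\to\mathbb C$ (spherical harmonics), indexed by $l=0,1,2,\dots$ and $m=-l,-l+1,\dots,l$, such that: (i) The functions $Y_l^m$ form an orthonormal (Hilbert) basis of $\mathcal E_1$. They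 lie in the domains of $H_3$ and $H^2$ and are common eigenfunctions of them: $$H_3Y_l^m=m\,Y_l^m,\qquad H^2Y_l^m=l(l+1)\,Y_l^m .$$ (ii) $Y_l^m(\theta,\varphi)=F_l^m(\theta)e^{im\varphi}$ for all $\theta\in[0,\pi]$ and $\varphi\in\mathbb R$, where the functions $F_l^m:[0,\pi]\to\mathbb R$ are real valued. Moreover, for all $l$ and $m$ as above the joint eigenspace $\{\psi\in\mathcal E_1:\ H_3\psi=m\psi,\ H^2\psi=l(l+1)\psi\}$ is one-dimensional, and if $\{\psi\in\mathcal E_1:\ H_3\psi=a\psi,\ H^2\psi=b\psi\}\ne\{0\}$ for some $a,b\in\mathbb C$, then $a=m$ and $b=l(l+1)$ for such a pair $(l,m)$. -/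

import Mathlib

open MeasureTheory
open scoped Manifold ContDiff

noncomputable section

namespace SphericalHarmonics

/-- Euclidean three-space. The coordinate axes `e₁, e₂, e₃` carry the indices `0, 1, 2`. -/
abbrev E3 : Type := EuclideanSpace ℝ (Fin 3)

/-- The unit sphere `|x| = 1`. -/
abbrev S2 : Type := Metric.sphere (0 : E3) 1

/-- The surface measure on the unit sphere. -/
abbrev dS : Measure S2 := (volume : Measure E3).toSphere

/-- The complex Hilbert space of square integrable functions on the sphere. -/
abbrev L2S : Type := Lp ℂ 2 dS

/-- The rotation of the space around the axis `k` by the angle `t`, in the positive direction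
(from the axis `k + 1` towards the axis `k + 2`, indices being cyclic). -/
def axisRot (k : Fin 3) (t : ℝ) : E3 →ₗᵢ[ℝ] E3 where
  toFun x := WithLp.toLp 2 fun j =>
    if j = k then x k
    else if j = k + 1 then Real.cos t * x (k + 1) - Real.sin t * x (k + 2)
    else Real.sin t * x (k + 1) + Real.cos t * x (k + 2)
  map_add' x y := by
    ext j
    simp only [PiLp.add_apply]
    split_ifs <;> ring
  map_smul' c x := by
    ext j
    simp only [PiLp.smul_apply, smul_eq_mul, RingHom.id_apply]
    split_ifs <;> ring
  norm_map' x := by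
    rw [EuclideanSpace.norm_eq, EuclideanSpace.norm_eq]
    congr 1
    have h := Real.sin_sq_add_cos_sq t
    fin_cases k <;> simp [Fin.sum_univ_three, Real.norm_eq_abs, sq_abs]
    · linear_combination (x 1 ^ 2 + x 2 ^ 2) * h
    · linear_combination (x 2 ^ 2 + x 0 ^ 2) * h
    · linear_combination (x 0 ^ 2 + x 1 ^ 2) * h

/-- The rotation, restricted to the sphere. -/
def sphereRotation (k : Fin 3) (t : ℝ) (x : S2) : S2 :=
  ⟨axisRot k t x, by simp⟩

theorem continuous_sphereRotation (k : Fin 3) (t : ℝ) : Continuous (sphereRotation k t) :=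
  Continuous.subtype_mk ((axisRot k t).continuous.comp continuous_subtype_val) _

open scoped Pointwise in
theorem measurePreserving_sphereRotation (k : Fin 3) (t : ℝ) :
    MeasurePreserving (sphereRotation k t) dS dS := by
  have hm := (continuous_sphereRotation k t).measurable
  refine ⟨hm, Measure.ext fun s hs => ?_⟩
  rw [Measure.map_apply hm hs, Measure.toSphere_apply' _ hs, Measure.toSphere_apply' _ (hm hs)]
  congr 1
  let e : E3 ≃ₗᵢ[ℝ] E3 := (axisRot k t).toLinearIsometryEquiv rfl
  have he : ∀ x, e x = axisRot k t x := fun x => rfl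
  have hp : MeasurePreserving e.toMeasurableEquiv volume volume := e.measurePreserving
  rw [← hp.measure_preimage_equiv (Set.Ioo (0 : ℝ) 1 • (Subtype.val '' s))]
  congr 1
  ext x
  simp only [Set.mem_preimage, Set.mem_smul, Set.mem_image, Subtype.exists]
  constructor
  · rintro ⟨r, hr, _, ⟨y, hy, hys, rfl⟩, rfl⟩
    refine ⟨r, hr, _, ⟨axisRot k t y, (sphereRotation k t ⟨y, hy⟩).2, hys, rfl⟩, ?_⟩
    exact ((axisRot k t).map_smul r y).symm
  · rintro ⟨r, hr, _, ⟨y, hy, hys, rfl⟩, hxy⟩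
    have hy' : axisRot k t (e.symm y) = y := e.apply_symm_apply y
    have hn : e.symm y ∈ Metric.sphere (0 : E3) 1 := by simpa using hy
    refine ⟨r, hr, _, ⟨e.symm y, hn, ?_, rfl⟩, ?_⟩
    · have : sphereRotation k t ⟨e.symm y, hn⟩ = ⟨y, hy⟩ := Subtype.ext hy'
      rwa [this]
    · apply e.injective
      change e (r • e.symm y) = e x
      rw [map_smul, e.apply_symm_apply]
      exact hxy

/-- The rotation group on `L²(S²)`: `(R̂ₖ(t) ψ)(x) = ψ(Rₖ(t) x)`. -/
def rotHat (k : Fin 3) (t : ℝ) : L2S →ₗ[ℂ] L2S :=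
  Lp.compMeasurePreservingₗ ℂ (sphereRotation k t) (measurePreserving_sphereRotation k t)

/-- The generator `d/dt R̂ₖ(t)` at `t = 0`, an unbounded operator on `L²(S²)`; its domain
consists of all `ψ` for which the derivative exists in the norm of `L²(S²)`. -/
def rotGenerator (k : Fin 3) : L2S →ₗ.[ℂ] L2S where
  domain :=
    { carrier := {ψ | DifferentiableAt ℝ (fun t : ℝ => rotHat k t ψ) 0}
      add_mem' := fun {a b} ha hb => by
        simp only [Set.mem_ofPred_eq, map_add] at *
        exact ha.add hb
      zero_mem' := by simp
      smul_mem' := fun c a ha => by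
        simp only [Set.mem_ofPred_eq, map_smul] at *
        exact ha.const_smul c }
  toFun :=
    { toFun := fun ψ => deriv (fun t : ℝ => rotHat k t (ψ : L2S)) 0
      map_add' := fun a b => by
        simp only [Submodule.coe_add, map_add]
        exact deriv_fun_add a.2 b.2
      map_smul' := fun c a => by
        simp only [Submodule.coe_smul, map_smul, RingHom.id_apply]
        exact deriv_fun_const_smul c a.2 }

/-- The angular momentum operator `Hₖ = -i d/dt R̂ₖ(t)` at `t = 0`. -/
def H (k : Fin 3) : L2S →ₗ.[ℂ] L2S := (-Complex.I) • rotGenerator k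

/-- The square `T²` of an unbounded operator, on its natural domain
`{ψ ∈ D(T) : T ψ ∈ D(T)}`. -/
def square {V : Type*} [AddCommGroup V] [Module ℂ V] (T : V →ₗ.[ℂ] V) : V →ₗ.[ℂ] V where
  domain :=
    { carrier := {ψ | ∃ h : ψ ∈ T.domain, T ⟨ψ, h⟩ ∈ T.domain}
      add_mem' := by
        rintro a b ⟨ha, ha'⟩ ⟨hb, hb'⟩
        refine ⟨T.domain.add_mem ha hb, ?_⟩
        have := T.map_add ⟨a, ha⟩ ⟨b, hb⟩
        rw [AddMemClass.mk_add_mk] at this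
        rw [this]
        exact T.domain.add_mem ha' hb'
      zero_mem' := ⟨T.domain.zero_mem, by
        have : T ⟨0, T.domain.zero_mem⟩ = 0 := T.map_zero
        rw [this]
        exact T.domain.zero_mem⟩
      smul_mem' := by
        rintro c a ⟨ha, ha'⟩
        refine ⟨T.domain.smul_mem c ha, ?_⟩
        have : T ⟨c • a, T.domain.smul_mem c ha⟩ = c • T ⟨a, ha⟩ := T.map_smul c ⟨a, ha⟩
        rw [this]
        exact T.domain.smul_mem c ha' }
  toFun :=
    { toFun := fun ψ => T ⟨T ⟨ψ, ψ.2.1⟩, ψ.2.2⟩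
      map_add' := fun a b => by
        rw [← T.map_add]
        congr 1
        exact Subtype.ext (T.map_add ⟨a, a.2.1⟩ ⟨b, b.2.1⟩)
      map_smul' := fun c a => by
        rw [RingHom.id_apply, ← T.map_smul]
        congr 1
        exact Subtype.ext (T.map_smul c ⟨a, a.2.1⟩) }

/-- `H² = H₁² + H₂² + H₃²`; the domain of the sum is the intersection of the three domains. -/
def Hsq : L2S →ₗ.[ℂ] L2S := square (H 0) + square (H 1) + square (H 2)

/-- The joint eigenspace of `H₃` (eigenvalue `a`) and `H²` (eigenvalue `b`). -/
def jointEigenspace (a b : ℂ) : Submodule ℂ L2S where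
  carrier := {ψ | (∃ h : ψ ∈ (H 2).domain, H 2 ⟨ψ, h⟩ = a • ψ) ∧
    ∃ h : ψ ∈ Hsq.domain, Hsq ⟨ψ, h⟩ = b • ψ}
  add_mem' := by
    rintro x y ⟨⟨hx, hx'⟩, kx, kx'⟩ ⟨⟨hy, hy'⟩, ky, ky'⟩
    refine ⟨⟨add_mem hx hy, ?_⟩, add_mem kx ky, ?_⟩
    · rw [smul_add, ← hx', ← hy']
      exact (H 2).map_add ⟨x, hx⟩ ⟨y, hy⟩
    · rw [smul_add, ← kx', ← ky']
      exact Hsq.map_add ⟨x, kx⟩ ⟨y, ky⟩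
  zero_mem' := by
    refine ⟨⟨zero_mem _, ?_⟩, zero_mem _, ?_⟩
    · rw [smul_zero]
      exact (H 2).map_zero
    · rw [smul_zero]
      exact Hsq.map_zero
  smul_mem' := by
    rintro c x ⟨⟨hx, hx'⟩, kx, kx'⟩
    refine ⟨⟨Submodule.smul_mem _ c hx, ?_⟩, Submodule.smul_mem _ c kx, ?_⟩
    · rw [smul_comm, ← hx']
      exact (H 2).map_smul c ⟨x, hx⟩
    · rw [smul_comm, ← kx']
      exact Hsq.map_smul c ⟨x, kx⟩

/-- The point of the sphere with polar angle `θ` and azimuth `φ`. -/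
def sphPoint (θ φ : ℝ) : S2 :=
  ⟨!₂[Real.sin θ * Real.cos φ, Real.sin θ * Real.sin φ, Real.cos θ], by
    rw [mem_sphere_zero_iff_norm, EuclideanSpace.norm_eq, Real.sqrt_eq_one]
    simp only [Fin.sum_univ_three, Real.norm_eq_abs, sq_abs]
    simp
    linear_combination (Real.sin θ ^ 2) * Real.sin_sq_add_cos_sq φ + Real.sin_sq_add_cos_sq θ⟩

/-- The pairs `(l, m)` with `l = 0, 1, 2, …` and `m = -l, -l + 1, …, l`. -/
abbrev Index : Type := Σ l : ℕ, {m : ℤ // -(l : ℤ) ≤ m ∧ m ≤ (l : ℤ)}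

end SphericalHarmonics

end

noncomputable section

namespace SphericalHarmonics

open Polynomial

/-! ### Symmetry of the angular momentum operators -/

/-! The proof has two independent halves: explicit eigenfunctions, and the symmetry of the
operators.

Eigenfunctions: `(x₁ ± i x₂)ⁿ q(x₃)` with `q` a polynomial is always an eigenvector of `H₃` for `±
n`, and on such functions `H²` acts as a second-order differential operator on `q`
(`exists_hasRotDeriv_hasRotDeriv_planarMul`). The derivative of `(X² - 1)ˡ` of order `l + n` solves
the resulting equation with eigenvalue `l (l + 1)` (`legendreDeriv_ode`). For fixed `n` these
solutions have each degree exactly once, so they span all `q`. With Stone–Weierstrass, the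
eigenfunctions span a dense subspace of `C(S)`, hence of `L²`.

Symmetry: rotations preserve the inner product, so `Hₖ` and `H²` are symmetric on their domains and
joint eigenvectors with different eigenvalue pairs are orthogonal. Since `(l, m)` is determined by
`(l (l + 1), m)`, the normalized eigenfunctions form a Hilbert basis. A nonzero joint eigenvector is
not orthogonal to all of them, so it shares its eigenvalues with one; this rules out further
eigenvalues and gives dimension one. -/

theorem mem_H_domain_of_hasDerivAt {k : Fin 3} {ψ χ : L2S}
    (h : HasDerivAt (fun t : ℝ => rotHat k t ψ) χ 0) :
    ∃ hψ : ψ ∈ (H k).domain, H k ⟨ψ, hψ⟩ = (-Complex.I) • χ := by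
  refine ⟨h.differentiableAt, ?_⟩
  change (-Complex.I) • deriv (fun t : ℝ => rotHat k t ψ) 0 = _
  rw [h.deriv]

theorem hasDerivAt_rotHat {k : Fin 3} {ψ : L2S} (hψ : ψ ∈ (H k).domain) :
    HasDerivAt (fun t : ℝ => rotHat k t ψ) (Complex.I • H k ⟨ψ, hψ⟩) 0 := by
  have h : DifferentiableAt ℝ (fun t : ℝ => rotHat k t ψ) 0 := hψ
  have e : H k ⟨ψ, hψ⟩ = (-Complex.I) • deriv (fun t : ℝ => rotHat k t ψ) 0 := rfl
  rw [e, smul_smul, mul_neg, Complex.I_mul_I, neg_neg, one_smul]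
  exact h.hasDerivAt

theorem inner_rotHat (k : Fin 3) (t : ℝ) (φ ψ : L2S) :
    inner ℂ (rotHat k t φ) (rotHat k t ψ) = inner ℂ φ ψ :=
  (Lp.compMeasurePreservingₗᵢ ℂ (sphereRotation k t)
    (measurePreserving_sphereRotation k t)).inner_map_map φ ψ

theorem sphereRotation_zero (k : Fin 3) : sphereRotation k 0 = id := by
  funext x
  refine Subtype.ext (PiLp.ext fun j => ?_)
  change (if j = k then (x : E3) k
    else if j = k + 1 then Real.cos 0 * (x : E3) (k + 1) - Real.sin 0 * (x : E3) (k + 2)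
    else Real.sin 0 * (x : E3) (k + 1) + Real.cos 0 * (x : E3) (k + 2)) = (x : E3) j
  fin_cases k <;> fin_cases j <;> simp

theorem rotHat_zero (k : Fin 3) (ψ : L2S) : rotHat k 0 ψ = ψ := by
  change Lp.compMeasurePreserving (sphereRotation k 0) _ ψ = ψ
  -- The proof of measure preservation depends on the map, so the map is replaced by a variable
  -- before substituting `id`.
  have : ∀ (f : S2 → S2) (hf : MeasurePreserving f dS dS), f = id →
      Lp.compMeasurePreserving f hf ψ = ψ := by
    rintro f hf rfl
    exact Lp.compMeasurePreserving_id_apply ψ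
  exact this _ _ (sphereRotation_zero k)

/-- Differentiate the constant function `t ↦ ⟨R̂(t) φ, R̂(t) ψ⟩` at `0`; the factors `i` and `conj i
= -i` turn the product rule into symmetry. -/
theorem inner_H_left {k : Fin 3} {φ ψ : L2S} (hφ : φ ∈ (H k).domain) (hψ : ψ ∈ (H k).domain) :
    inner ℂ (H k ⟨φ, hφ⟩) ψ = inner ℂ φ (H k ⟨ψ, hψ⟩) := by
  have h := (hasDerivAt_rotHat hφ).inner ℂ (hasDerivAt_rotHat hψ)
  simp only [inner_rotHat, rotHat_zero, inner_smul_left, inner_smul_right, Complex.conj_I] at h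
  have h0 := h.unique (hasDerivAt_const _ _)
  have : Complex.I * (inner ℂ φ (H k ⟨ψ, hψ⟩) - inner ℂ (H k ⟨φ, hφ⟩) ψ) = 0 := by
    linear_combination h0
  exact (sub_eq_zero.1 ((mul_eq_zero.1 this).resolve_left Complex.I_ne_zero)).symm

theorem inner_square_H_left {k : Fin 3} {φ ψ : L2S} (hφ : φ ∈ (square (H k)).domain)
    (hψ : ψ ∈ (square (H k)).domain) :
    inner ℂ (square (H k) ⟨φ, hφ⟩) ψ = inner ℂ φ (square (H k) ⟨ψ, hψ⟩) := by
  change inner ℂ (H k ⟨H k ⟨φ, hφ.1⟩, hφ.2⟩) ψ = inner ℂ φ (H k ⟨H k ⟨ψ, hψ.1⟩, hψ.2⟩)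
  rw [inner_H_left hφ.2 hψ.1, inner_H_left hφ.1 hψ.2]

theorem inner_Hsq_left {φ ψ : L2S} (hφ : φ ∈ Hsq.domain) (hψ : ψ ∈ Hsq.domain) :
    inner ℂ (Hsq ⟨φ, hφ⟩) ψ = inner ℂ φ (Hsq ⟨ψ, hψ⟩) := by
  change inner ℂ (square (H 0) ⟨φ, hφ.1.1⟩ + square (H 1) ⟨φ, hφ.1.2⟩ + square (H 2) ⟨φ, hφ.2⟩) ψ
    = inner ℂ φ (square (H 0) ⟨ψ, hψ.1.1⟩ + square (H 1) ⟨ψ, hψ.1.2⟩ + square (H 2) ⟨ψ, hψ.2⟩)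
  simp only [inner_add_left, inner_add_right]
  rw [inner_square_H_left hφ.1.1 hψ.1.1, inner_square_H_left hφ.1.2 hψ.1.2,
    inner_square_H_left hφ.2 hψ.2]

/-- Joint eigenvectors with different pairs of eigenvalues, one pair real, are orthogonal. -/
theorem eq_of_inner_ne_zero_of_mem_jointEigenspace {a b a' b' : ℂ} {φ ψ : L2S}
    (ha : starRingEnd ℂ a = a) (hb : starRingEnd ℂ b = b)
    (hφ : φ ∈ jointEigenspace a b) (hψ : ψ ∈ jointEigenspace a' b') (h : inner ℂ φ ψ ≠ 0) :
    a' = a ∧ b' = b := by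
  obtain ⟨⟨h₁, e₁⟩, h₂, e₂⟩ := hφ
  obtain ⟨⟨k₁, f₁⟩, k₂, f₂⟩ := hψ
  have s₁ := inner_H_left h₁ k₁
  have s₂ := inner_Hsq_left h₂ k₂
  rw [e₁, f₁, inner_smul_left, inner_smul_right, ha] at s₁
  rw [e₂, f₂, inner_smul_left, inner_smul_right, hb] at s₂
  exact ⟨(mul_right_cancel₀ h s₁).symm, (mul_right_cancel₀ h s₂).symm⟩

/-! ### Derivatives along rotations of continuous functions -/

/-- The coordinate functions on the sphere. -/
def coord (j : Fin 3) : C(S2, ℂ) := ⟨fun x => (((x : E3) j : ℝ) : ℂ), by fun_prop⟩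

/-- Composition of continuous functions with a rotation. -/
def rotPullback (k : Fin 3) (t : ℝ) : C(S2, ℂ) →ₐ[ℂ] C(S2, ℂ) :=
  ContinuousMap.compRightAlgHom ℂ ℂ ⟨sphereRotation k t, continuous_sphereRotation k t⟩

theorem rotPullback_zero (k : Fin 3) (f : C(S2, ℂ)) : rotPullback k 0 f = f := by
  ext x
  change f (sphereRotation k 0 x) = f x
  rw [sphereRotation_zero, id]

/-- The function `g` is the derivative of `f` along the rotations around the axis `k`, uniformly
on the sphere. -/
def HasRotDeriv (k : Fin 3) (f g : C(S2, ℂ)) : Prop :=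
  HasDerivAt (fun t : ℝ => rotPullback k t f) g 0

namespace HasRotDeriv

variable {k : Fin 3} {f g f' g' : C(S2, ℂ)}

theorem add (hf : HasRotDeriv k f f') (hg : HasRotDeriv k g g') :
    HasRotDeriv k (f + g) (f' + g') := by
  simpa only [HasRotDeriv, map_add] using! HasDerivAt.add hf hg

theorem neg (hf : HasRotDeriv k f f') : HasRotDeriv k (-f) (-f') := by
  simpa only [HasRotDeriv, map_neg] using! HasDerivAt.neg hf

theorem smul (c : ℂ) (hf : HasRotDeriv k f f') : HasRotDeriv k (c • f) (c • f') := by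
  simpa only [HasRotDeriv, map_smul] using! HasDerivAt.const_smul c hf

theorem mul (hf : HasRotDeriv k f f') (hg : HasRotDeriv k g g') :
    HasRotDeriv k (f * g) (f' * g + f * g') := by
  have h := HasDerivAt.mul hf hg
  simp only [rotPullback_zero] at h
  simpa only [HasRotDeriv, map_mul] using! h

theorem algebraMap (k : Fin 3) (c : ℂ) : HasRotDeriv k (algebraMap ℂ C(S2, ℂ) c) 0 := by
  simpa only [HasRotDeriv, AlgHom.commutes] using! hasDerivAt_const (0 : ℝ) _

theorem pow (hf : HasRotDeriv k f f') (n : ℕ) :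
    HasRotDeriv k (f ^ n) ((n : C(S2, ℂ)) * f ^ (n - 1) * f') := by
  induction n with
  | zero => simpa using! algebraMap k 1
  | succ n ih =>
    rw [pow_succ]
    convert ih.mul hf using 1
    rcases n with _ | n
    · simp
    · push_cast [Nat.add_sub_cancel]
      ring

theorem aeval (hf : HasRotDeriv k f f') (p : ℂ[X]) :
    HasRotDeriv k (Polynomial.aeval f p) (Polynomial.aeval f (derivative p) * f') := by
  induction p using Polynomial.induction_on' with
  | add p q hp hq =>
    simp only [map_add, add_mul]
    exact hp.add hq
  | monomial n a =>
    rw [derivative_monomial, aeval_monomial, aeval_monomial]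
    convert (algebraMap k a).mul (hf.pow n) using 1
    simp only [map_mul, map_natCast]
    ring

/-- A uniform derivative along rotations is a derivative in the mean. -/
theorem toLp (hf : HasRotDeriv k f f') :
    HasDerivAt (fun t : ℝ => rotHat k t (ContinuousMap.toLp 2 dS ℂ f))
      (ContinuousMap.toLp 2 dS ℂ f') 0 :=
  -- `toLp` intertwines `rotPullback` and `rotHat` definitionally, and a continuous linear map
  -- preserves derivatives.
  ((ContinuousMap.toLp 2 dS ℂ : C(S2, ℂ) →L[ℂ] L2S).restrictScalars ℝ).hasFDerivAt.comp_hasDerivAt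
    (0 : ℝ) hf

theorem H_toLp (hf : HasRotDeriv k f f') :
    ∃ h : ContinuousMap.toLp 2 dS ℂ f ∈ (H k).domain,
      H k ⟨_, h⟩ = ContinuousMap.toLp 2 dS ℂ ((-Complex.I) • f') := by
  rw [map_smul]
  exact mem_H_domain_of_hasDerivAt hf.toLp

theorem square_H_toLp (hf : HasRotDeriv k f f') (hf' : HasRotDeriv k f' g) :
    ∃ h : ContinuousMap.toLp 2 dS ℂ f ∈ (square (H k)).domain,
      square (H k) ⟨_, h⟩ = ContinuousMap.toLp 2 dS ℂ (-g) := by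
  obtain ⟨h, e⟩ := hf.H_toLp
  obtain ⟨h', e'⟩ := (hf'.smul (-Complex.I)).H_toLp
  refine ⟨⟨h, e ▸ h'⟩, ?_⟩
  change H k ⟨H k ⟨_, h⟩, _⟩ = _
  simp only [e, e', smul_smul]
  congr 1
  ext x
  simp

end HasRotDeriv

/-- A rotated coordinate is a combination of fixed functions with coefficients `cos t`, `sin t`, so
uniform differentiability reduces to that of two scalar functions. -/
theorem hasRotDeriv_coord (k j : Fin 3) : HasRotDeriv k (coord j)
    (if j = k then 0 else if j = k + 1 then -coord (k + 2) else coord (k + 1)) := by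
  have key : ∀ t : ℝ, rotPullback k t (coord j) = if j = k then coord k
      else if j = k + 1 then Real.cos t • coord (k + 1) - Real.sin t • coord (k + 2)
      else Real.sin t • coord (k + 1) + Real.cos t • coord (k + 2) := by
    intro t
    ext x
    change (((if j = k then (x : E3) k
      else if j = k + 1 then Real.cos t * (x : E3) (k + 1) - Real.sin t * (x : E3) (k + 2)
      else Real.sin t * (x : E3) (k + 1) + Real.cos t * (x : E3) (k + 2) : ℝ)) : ℂ) = _
    split_ifs <;> simp [coord]
  simp only [HasRotDeriv, key]
  have hc := Real.hasDerivAt_cos 0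
  have hs := Real.hasDerivAt_sin 0
  split_ifs
  · exact hasDerivAt_const _ _
  · convert! (hc.smul_const (coord (k + 1))).sub (hs.smul_const (coord (k + 2))) using 1
    ext x
    simp
  · convert! (hs.smul_const (coord (k + 1))).add (hc.smul_const (coord (k + 2))) using 1
    ext x
    simp

theorem sum_sq_coord : coord 0 ^ 2 + coord 1 ^ 2 + coord 2 ^ 2 = 1 := by
  ext x
  have h : ‖(x : E3)‖ ^ 2 = 1 := by simp
  rw [EuclideanSpace.norm_sq_eq, Fin.sum_univ_three] at h
  simp only [Real.norm_eq_abs, sq_abs] at h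
  simp only [coord, ContinuousMap.add_apply, ContinuousMap.pow_apply, ContinuousMap.coe_mk,
    ContinuousMap.one_apply]
  exact_mod_cast h

/-! ### Derivatives of Legendre polynomials -/

/-- The `n`-th derivative of `(X² - 1)ˡ`. Up to a factor it is, for `n = l + m`, the `m`-th
derivative of the Legendre polynomial of degree `l`. -/
def legendreDeriv (R : Type*) [CommRing R] (l n : ℕ) : R[X] :=
  derivative^[n] ((X ^ 2 - 1) ^ l)

section legendreDeriv

variable {R : Type*} [CommRing R]

theorem derivative_legendreDeriv (l n : ℕ) :
    derivative (legendreDeriv R l n) = legendreDeriv R l (n + 1) :=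
  (Function.iterate_succ_apply' _ _ _).symm

/-- Identifies the complex polynomials with real ones, which makes `F` real valued. -/
theorem map_legendreDeriv {R' : Type*} [CommRing R'] (f : R →+* R') (l n : ℕ) :
    (legendreDeriv R l n).map f = legendreDeriv R' l n := by
  simp [legendreDeriv, ← iterate_derivative_map]

/-- The power `u = (X² - 1)ˡ` satisfies `(X² - 1) u' = 2 l X u`; differentiating this `n + 1` times
gives the equation. -/
theorem legendreDeriv_ode (l n : ℕ) :
    (X ^ 2 - 1) * legendreDeriv R l (n + 2)
      + 2 * ((n : R[X]) + 1 - (l : R[X])) * X * legendreDeriv R l (n + 1)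
      + ((n : R[X]) + 1) * ((n : R[X]) - 2 * (l : R[X])) * legendreDeriv R l n = 0 := by
  induction n with
  | zero =>
    have h0 : (X ^ 2 - 1) * legendreDeriv R l 1 - 2 * (l : R[X]) * X * legendreDeriv R l 0 = 0 := by
      rw [← derivative_legendreDeriv]
      simp only [legendreDeriv, Function.iterate_zero, id]
      rcases l with _ | l
      · simp
      · rw [derivative_pow]
        simp only [derivative_sub, derivative_X_pow, derivative_one, map_natCast]
        push_cast [Nat.add_sub_cancel]
        simp
        ring
    have h := congrArg derivative h0
    simp only [derivative_sub, derivative_mul, derivative_legendreDeriv, derivative_X_pow,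
      derivative_one, derivative_natCast, derivative_X, derivative_ofNat, derivative_zero,
      map_ofNat, Nat.cast_ofNat] at h
    push_cast
    linear_combination h
  | succ n ih =>
    have h := congrArg derivative ih
    simp only [derivative_sub, derivative_add, derivative_mul, derivative_legendreDeriv,
      derivative_X_pow, derivative_one, derivative_natCast, derivative_X, derivative_ofNat,
      derivative_zero, map_ofNat, Nat.cast_ofNat] at h
    push_cast
    linear_combination h

theorem degree_legendreDeriv [IsDomain R] [CharZero R] {l n d : ℕ} (h : n + d = 2 * l) :
    (legendreDeriv R l n).degree = d := by
  have hm : ((X ^ 2 - 1 : R[X]) ^ l).Monic := (monic_X_pow_sub_C (1 : R) two_ne_zero).pow l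
  have hd : ((X ^ 2 - 1 : R[X]) ^ l).natDegree = d + n := by
    have h2 : (X ^ 2 - 1 : R[X]).natDegree = 2 := by
      simpa using natDegree_X_pow_sub_C (n := 2) (r := (1 : R))
    rw [natDegree_pow, h2]
    lia
  refine le_antisymm ?_ ?_
  · refine degree_le_of_natDegree_le ?_
    have := natDegree_iterate_derivative ((X ^ 2 - 1 : R[X]) ^ l) n
    rw [hd] at this
    simpa [legendreDeriv] using this
  · refine le_degree_of_ne_zero ?_
    rw [legendreDeriv, coeff_iterate_derivative, ← hd, hm.coeff_natDegree, hd]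
    simp [Nat.descFactorial_eq_zero_iff_lt]

end legendreDeriv

/-! ### Explicit eigenfunctions -/

theorem smul_eq_algebraMap_mul (c : ℂ) (f : C(S2, ℂ)) : c • f = algebraMap ℂ C(S2, ℂ) c * f := by
  ext x
  simp

/-- The function `x₁ + i ε x₂` on the sphere, for `ε = ± 1`. -/
def planar (ε : ℂ) : C(S2, ℂ) := coord 0 + algebraMap ℂ C(S2, ℂ) (ε * Complex.I) * coord 1

/-- The function `(x₁ + i ε x₂)ⁿ q(x₃)` on the sphere. -/
def planarMul (ε : ℂ) (n : ℕ) (q : ℂ[X]) : C(S2, ℂ) := planar ε ^ n * aeval (coord 2) q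

theorem algebraMap_mul_I_sq {ε : ℂ} (hε : ε ^ 2 = 1) :
    algebraMap ℂ C(S2, ℂ) (ε * Complex.I) ^ 2 = -1 := by
  rw [← map_pow, mul_pow, hε, Complex.I_sq]
  simp

theorem hasRotDeriv_planar (k : Fin 3) (ε : ℂ) : HasRotDeriv k (planar ε)
    ((if 0 = k then 0 else if 0 = k + 1 then -coord (k + 2) else coord (k + 1)) +
      algebraMap ℂ C(S2, ℂ) (ε * Complex.I) *
        (if 1 = k then 0 else if 1 = k + 1 then -coord (k + 2) else coord (k + 1))) := by
  rw [planar]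
  convert (hasRotDeriv_coord k 0).add
    ((HasRotDeriv.algebraMap k (ε * Complex.I)).mul (hasRotDeriv_coord k 1)) using 2
  rw [zero_mul, zero_add]

theorem hasRotDeriv_zero_planar (ε : ℂ) : HasRotDeriv 0 (planar ε)
    (-(algebraMap ℂ C(S2, ℂ) (ε * Complex.I) * coord 2)) := by
  convert hasRotDeriv_planar 0 ε using 1
  change _ = 0 + _ * -coord 2
  ring

theorem hasRotDeriv_one_planar (ε : ℂ) : HasRotDeriv 1 (planar ε) (coord 2) := by
  simpa using! hasRotDeriv_planar 1 ε

theorem hasRotDeriv_two_planar {ε : ℂ} (hε : ε ^ 2 = 1) : HasRotDeriv 2 (planar ε)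
    (algebraMap ℂ C(S2, ℂ) (ε * Complex.I) * planar ε) := by
  convert hasRotDeriv_planar 2 ε using 1
  have hI := algebraMap_mul_I_sq hε
  rw [planar, if_neg (by decide), if_pos (by decide), if_neg (by decide), if_neg (by decide)]
  change _ = -coord 1 + _ * coord 0
  linear_combination coord 1 * hI

theorem hasRotDeriv_zero_coord_two : HasRotDeriv 0 (coord 2) (coord 1) := hasRotDeriv_coord 0 2

theorem hasRotDeriv_one_coord_two : HasRotDeriv 1 (coord 2) (-coord 0) := hasRotDeriv_coord 1 2

theorem hasRotDeriv_two_coord_two : HasRotDeriv 2 (coord 2) 0 := hasRotDeriv_coord 2 2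

/-- Rotation around the third axis fixes `x₃` and multiplies `x₁ + i ε x₂` by a phase. -/
theorem hasRotDeriv_two_planarMul {ε : ℂ} (hε : ε ^ 2 = 1) (n : ℕ) (q : ℂ[X]) :
    HasRotDeriv 2 (planarMul ε n q) ((ε * n * Complex.I) • planarMul ε n q) := by
  rw [smul_eq_algebraMap_mul, planarMul, show ε * n * Complex.I = n * (ε * Complex.I) by ring,
    map_mul, map_natCast]
  convert ((hasRotDeriv_two_planar hε).pow n).mul (hasRotDeriv_two_coord_two.aeval q) using 1
  rcases n with _ | n
  · simp
  · rw [Nat.add_sub_cancel]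
    ring

/-- The functions `(x₁ + i ε x₂)ⁿ q(x₃)` have second derivatives along rotations, whose sum is
given by a differential operator acting on `q`. -/
theorem exists_hasRotDeriv_hasRotDeriv_planarMul {ε : ℂ} (hε : ε ^ 2 = 1) (n : ℕ) (q : ℂ[X]) :
    ∃ f g : Fin 3 → C(S2, ℂ), (∀ k, HasRotDeriv k (planarMul ε n q) (f k)) ∧
      (∀ k, HasRotDeriv k (f k) (g k)) ∧
      g 0 + g 1 + g 2 = planarMul ε n ((1 - X ^ 2) * derivative (derivative q)
        - 2 * ((n : ℂ[X]) + 1) * X * derivative q - (n : ℂ[X]) * ((n : ℂ[X]) + 1) * q) := by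
  have hI := algebraMap_mul_I_sq hε
  set J := algebraMap ℂ C(S2, ℂ) (ε * Complex.I) with hJ
  have dJ : ∀ k, HasRotDeriv k J 0 := fun k => HasRotDeriv.algebraMap k _
  have dn : ∀ k (m : ℕ), HasRotDeriv k (m : C(S2, ℂ)) 0 := fun k m => by
    simpa using HasRotDeriv.algebraMap k (m : ℂ)
  have w0 := hasRotDeriv_zero_planar ε
  have w1 := hasRotDeriv_one_planar ε
  rw [← hJ] at w0
  have c0 := hasRotDeriv_zero_coord_two
  have c1 := hasRotDeriv_one_coord_two
  have d01 : HasRotDeriv 0 (coord 1) (-coord 2) := hasRotDeriv_coord 0 1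
  have d10 : HasRotDeriv 1 (coord 0) (coord 2) := hasRotDeriv_coord 1 0
  have f0 := (w0.pow n).mul (c0.aeval q)
  have f1 := (w1.pow n).mul (c1.aeval q)
  have f2 := hasRotDeriv_two_planarMul hε n q
  have g0 := (((dn 0 n).mul (w0.pow (n - 1))).mul ((dJ 0).mul c0).neg).mul (c0.aeval q) |>.add
    ((w0.pow n).mul ((c0.aeval (derivative q)).mul d01))
  have g1 := (((dn 1 n).mul (w1.pow (n - 1))).mul c1).mul (c1.aeval q) |>.add
    ((w1.pow n).mul ((c1.aeval (derivative q)).mul d10.neg))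
  have g2 := f2.smul (ε * n * Complex.I)
  refine ⟨![_, _, _], ![_, _, _], Fin.forall_fin_succ.2 ⟨f0, Fin.forall_fin_two.2 ⟨f1, f2⟩⟩,
    Fin.forall_fin_succ.2 ⟨g0, Fin.forall_fin_two.2 ⟨g1, g2⟩⟩, ?_⟩
  simp only [Matrix.cons_val_zero, Matrix.cons_val_one, Matrix.cons_val]
  rw [smul_eq_algebraMap_mul, smul_eq_algebraMap_mul,
    show ε * n * Complex.I = n * (ε * Complex.I) by ring, map_mul, map_natCast, ← hJ]
  have hw : planar ε = coord 0 + J * coord 1 := rfl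
  have hs := sum_sq_coord
  simp only [planarMul, map_sub, map_mul, map_add, map_natCast, map_one, map_pow, aeval_X,
    map_ofNat]
  -- What remains is an identity in a commutative ring, modulo `x² + y² + z² = 1`, `J² = -1` and `w
  -- = x + J y`.
  generalize aeval (coord 2) (derivative (derivative q)) = q2 at *
  generalize aeval (coord 2) (derivative q) = q1 at *
  generalize aeval (coord 2) q = q0 at *
  clear f0 f1 f2 g0 g1 g2 w0 w1 c0 c1 d01 d10 dJ dn
  clear_value J
  generalize planar ε = w at *
  generalize coord 0 = x at *
  generalize coord 1 = y at *
  generalize coord 2 = z at *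
  -- The second derivatives contain the truncated exponents `n - 1` and `n - 1 - 1`.
  rcases n with _ | _ | n
  · simp only [Nat.cast_zero, pow_zero]
    linear_combination q2 * hs
  · simp only [zero_add, Nat.cast_one, Nat.sub_self, pow_zero, pow_one, Nat.cast_zero]
    linear_combination w * q2 * hs + w * q0 * hI + (q0 + 2 * z * q1) * hw
  · simp only [Nat.add_sub_cancel, show n + 1 + 1 - 1 = n + 1 by lia]
    push_cast
    linear_combination w ^ (n + 2) * q2 * hs
      + ((n + 2) ^ 2 * w ^ (n + 2) * q0 + (n + 2) * (n + 1) * w ^ n * z ^ 2 * q0) * hI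
      + (n + 2) * w ^ (n + 1) * (q0 + 2 * z * q1) * hw

/-- At order `l + n` the last coefficient in `legendreDeriv_ode` is `(l + n + 1)(n - l) = n (n + 1)
- l (l + 1)`, which matches the operator on `q`. -/
theorem toLp_planarMul_legendreDeriv_mem_jointEigenspace {ε : ℂ} (hε : ε ^ 2 = 1) (l n : ℕ) :
    ContinuousMap.toLp 2 dS ℂ (planarMul ε n (legendreDeriv ℂ l (l + n))) ∈
      jointEigenspace (ε * n) ((l : ℂ) * ((l : ℂ) + 1)) := by
  refine ⟨?_, ?_⟩
  · obtain ⟨h, e⟩ := (hasRotDeriv_two_planarMul hε n (legendreDeriv ℂ l (l + n))).H_toLp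
    refine ⟨h, e.trans ?_⟩
    rw [← map_smul, smul_smul, show -Complex.I * (ε * n * Complex.I) = ε * n by
      linear_combination (-ε * n) * Complex.I_mul_I]
  · obtain ⟨f, g, hf, hg, hsum⟩ :=
      exists_hasRotDeriv_hasRotDeriv_planarMul hε n (legendreDeriv ℂ l (l + n))
    obtain ⟨h0, e0⟩ := (hf 0).square_H_toLp (hg 0)
    obtain ⟨h1, e1⟩ := (hf 1).square_H_toLp (hg 1)
    obtain ⟨h2, e2⟩ := (hf 2).square_H_toLp (hg 2)
    refine ⟨⟨⟨h0, h1⟩, h2⟩, ?_⟩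
    change square (H 0) ⟨_, h0⟩ + square (H 1) ⟨_, h1⟩ + square (H 2) ⟨_, h2⟩ = _
    rw [e0, e1, e2, ← map_add, ← map_add, ← map_smul]
    congr 1
    have hode := legendreDeriv_ode (R := ℂ) l (l + n)
    have hq : (1 - X ^ 2) * derivative (derivative (legendreDeriv ℂ l (l + n)))
        - 2 * ((n : ℂ[X]) + 1) * X * derivative (legendreDeriv ℂ l (l + n))
        - (n : ℂ[X]) * ((n : ℂ[X]) + 1) * legendreDeriv ℂ l (l + n)
        = -(C ((l : ℂ) * ((l : ℂ) + 1)) * legendreDeriv ℂ l (l + n)) := by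
      simp only [derivative_legendreDeriv, map_mul, map_add, map_natCast, map_one]
      push_cast at hode
      linear_combination -hode
    rw [hq] at hsum
    rw [smul_eq_algebraMap_mul]
    simp only [planarMul, map_neg, map_mul, aeval_C] at hsum ⊢
    linear_combination -hsum

/-! ### Spherical coordinates -/

theorem planarMul_apply (ε : ℂ) (n : ℕ) (q : ℂ[X]) (x : S2) :
    planarMul ε n q x = planar ε x ^ n * q.eval (coord 2 x) := by
  have hq : aeval (coord 2) q x = q.eval (coord 2 x) := by
    rw [← coe_aeval_eq_eval]
    exact (Polynomial.aeval_algHom_apply (ContinuousMap.evalAlgHom ℂ ℂ x) (coord 2) q).symm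
  rw [planarMul, ContinuousMap.mul_apply, ContinuousMap.pow_apply, hq]

theorem planarMul_sphPoint {ε : ℂ} (hε : ε = 1 ∨ ε = -1) (n : ℕ) (q : ℂ[X]) (θ φ : ℝ) :
    planarMul ε n q (sphPoint θ φ) =
      (Real.sin θ : ℂ) ^ n * q.eval (Real.cos θ : ℂ) * Complex.exp (Complex.I * (ε * n) * φ) := by
  have hw : planar ε (sphPoint θ φ) = Real.sin θ * Complex.exp (ε * φ * Complex.I) := by
    rw [planar]
    rcases hε with rfl | rfl
    · rw [one_mul, Complex.exp_mul_I]
      simp [coord, sphPoint]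
      ring
    · rw [Complex.exp_mul_I]
      simp [coord, sphPoint]
      ring
  have h2 : coord 2 (sphPoint θ φ) = (Real.cos θ : ℂ) := by simp [coord, sphPoint]
  rw [planarMul_apply, hw, h2, mul_pow,
    ← Complex.exp_nat_mul, show (n : ℂ) * (ε * φ * Complex.I) = Complex.I * (ε * n) * φ by ring]
  ring

theorem planarMul_ne_zero {ε : ℂ} (hε : ε = 1 ∨ ε = -1) (n : ℕ) {q : ℂ[X]} (hq : q ≠ 0) :
    planarMul ε n q ≠ 0 := by
  intro h
  -- A zero of `q` is avoided inside the open interval, where `sin θ` does not vanish either.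
  obtain ⟨x, hx, hxq⟩ : ∃ x ∈ Set.Ioo (-1 : ℝ) 1, q.eval (x : ℂ) ≠ 0 := by
    by_contra! hcon
    refine hq (eq_zero_of_infinite_isRoot q (Set.Infinite.mono ?_
      ((Set.Ioo_infinite (show (-1 : ℝ) < 1 by norm_num)).image
        Complex.ofReal_injective.injOn)))
    rintro _ ⟨x, hx, rfl⟩
    exact hcon x hx
  have h0 := planarMul_sphPoint hε n q (Real.arccos x) 0
  rw [h, Real.cos_arccos hx.1.le hx.2.le, Real.sin_arccos] at h0
  have hs : (√(1 - x ^ 2) : ℂ) ≠ 0 := by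
    rw [Complex.ofReal_ne_zero]
    exact (Real.sqrt_pos.2 (by nlinarith [hx.1, hx.2])).ne'
  simp [hs, hxq] at h0

/-! ### Smoothness -/

theorem contMDiff_planarMul (ε : ℂ) (n : ℕ) (q : ℂ[X]) :
    ContMDiff (𝓡 2) 𝓘(ℝ, ℂ) ∞ (planarMul ε n q) := by
  let G : E3 → ℂ := fun x => ((x 0 : ℂ) + ε * Complex.I * (x 1 : ℂ)) ^ n * q.eval (x 2 : ℂ)
  have hx : ∀ j, ContDiff ℝ ∞ fun x : E3 => ((x j : ℝ) : ℂ) := fun j =>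
    Complex.ofRealCLM.contDiff.comp (by fun_prop)
  have hp : ContDiff ℂ ∞ fun z : ℂ => q.eval z := by
    simpa only [coe_aeval_eq_eval] using Polynomial.contDiff_aeval (𝕜 := ℂ) q ∞
  have hG : ContDiff ℝ ∞ G :=
    (((hx 0).add (contDiff_const.mul (hx 1))).pow n).mul
      ((hp.restrict_scalars ℝ).comp (hx 2))
  have e : ⇑(planarMul ε n q) = G ∘ ((↑) : S2 → E3) := by
    funext x
    rw [planarMul_apply]
    simp [G, planar, coord]
  rw [e]
  have : Fact (Module.finrank ℝ E3 = 2 + 1) := ⟨finrank_euclideanSpace_fin⟩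
  exact hG.contMDiff.comp contMDiff_coe_sphere

/-! ### Completeness -/

theorem planar_one_mul_planar_neg_one :
    planar 1 * planar (-1) = aeval (coord 2) (1 - X ^ 2 : ℂ[X]) := by
  have hI := algebraMap_mul_I_sq (one_pow 2)
  have hs := sum_sq_coord
  simp only [planar, map_sub, map_one, map_pow, aeval_X, neg_mul, map_neg]
  linear_combination hs - coord 1 ^ 2 * hI

theorem star_coord (j : Fin 3) : star (coord j) = coord j := by
  ext x
  simp [coord]

theorem star_planar_one : star (planar 1) = planar (-1) := by
  ext x
  simp [planar, coord]

/-- The products of powers of `x₁ ± i x₂` with polynomials in `x₃` form a monoid. -/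
def planarMonoid : Submonoid C(S2, ℂ) where
  carrier := {f | ∃ ε : ℂ, (ε = 1 ∨ ε = -1) ∧ ∃ n q, f = planarMul ε n q}
  one_mem' := ⟨1, Or.inl rfl, 0, 1, by simp [planarMul]⟩
  mul_mem' := by
    -- For opposite signs, `(x₁ + i x₂)(x₁ - i x₂) = 1 - x₃²` absorbs the smaller exponent into the
    -- polynomial.
    have key : ∀ (n m : ℕ) (q r : ℂ[X]), ∃ ε : ℂ, (ε = 1 ∨ ε = -1) ∧ ∃ k s,
        planarMul 1 n q * planarMul (-1) m r = planarMul ε k s := by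
      intro n m q r
      have hz := planar_one_mul_planar_neg_one
      rcases le_total m n with h | h
      · obtain ⟨d, rfl⟩ := Nat.exists_eq_add_of_le h
        refine ⟨1, Or.inl rfl, d, (1 - X ^ 2) ^ m * q * r, ?_⟩
        simp only [planarMul, map_mul, map_pow _ (1 - X ^ 2 : ℂ[X]), ← hz]
        ring
      · obtain ⟨d, rfl⟩ := Nat.exists_eq_add_of_le h
        refine ⟨-1, Or.inr rfl, d, (1 - X ^ 2) ^ n * q * r, ?_⟩
        simp only [planarMul, map_mul, map_pow _ (1 - X ^ 2 : ℂ[X]), ← hz]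
        ring
    rintro _ _ ⟨ε, hε, n, q, rfl⟩ ⟨δ, hδ, m, r, rfl⟩
    have same : ∀ ε : ℂ, planarMul ε n q * planarMul ε m r = planarMul ε (n + m) (q * r) := by
      intro ε
      simp only [planarMul, map_mul]
      ring
    rcases hε with rfl | rfl <;> rcases hδ with rfl | rfl
    · exact ⟨1, Or.inl rfl, _, _, same 1⟩
    · exact key n m q r
    · rw [mul_comm]
      exact key m n r q
    · exact ⟨-1, Or.inr rfl, _, _, same (-1)⟩

/-- Stone–Weierstrass for the star algebra generated by `x₁ + i x₂` and `x₃`. It is spanned by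
products of the generators and their conjugates, all of which lie in `planarMonoid`. -/
theorem topologicalClosure_span_planarMonoid :
    (Submodule.span ℂ (planarMonoid : Set C(S2, ℂ))).topologicalClosure = ⊤ := by
  let A : StarSubalgebra ℂ C(S2, ℂ) := StarAlgebra.adjoin ℂ {planar 1, coord 2}
  have hz : planar 1 ∈ A := StarAlgebra.subset_adjoin ℂ _ (by simp)
  have h2 : coord 2 ∈ A := StarAlgebra.subset_adjoin ℂ _ (by simp)
  have hz' : planar (-1) ∈ A := star_planar_one ▸ star_mem hz
  have hA : A.SeparatesPoints := by
    intro x y hxy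
    by_contra! hcon
    have e : ∀ f ∈ A, f x = f y := fun f hf => hcon f ⟨f, hf, rfl⟩
    have ez := e _ hz
    have ez' := e _ hz'
    have e2 := e _ h2
    simp only [planar, ContinuousMap.add_apply, ContinuousMap.mul_apply,
      _root_.algebraMap_apply, smul_eq_mul, mul_one, one_mul] at ez ez'
    have e0 : coord 0 x = coord 0 y := by linear_combination (ez + ez') / 2
    have e1 : coord 1 x = coord 1 y := by
      linear_combination (-Complex.I / 2) * (ez - ez') +
        (coord 1 x - coord 1 y) * Complex.I_mul_I
    refine hxy (Subtype.ext (PiLp.ext fun j => ?_))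
    fin_cases j
    · exact Complex.ofReal_injective e0
    · exact Complex.ofReal_injective e1
    · exact Complex.ofReal_injective e2
  have hA' := ContinuousMap.starSubalgebra_topologicalClosure_eq_top_of_separatesPoints A hA
  have hle : Subalgebra.toSubmodule A.toSubalgebra ≤
      Submodule.span ℂ (planarMonoid : Set C(S2, ℂ)) := by
    rw [StarAlgebra.adjoin_toSubalgebra, Algebra.adjoin_eq_span]
    refine Submodule.span_mono (Submonoid.closure_le.2 ?_)
    have m2 : coord 2 ∈ planarMonoid := ⟨1, Or.inl rfl, 0, X, by simp [planarMul]⟩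
    rintro f (hf | hf)
    · rcases hf with rfl | rfl
      · exact ⟨1, Or.inl rfl, 1, 1, by simp [planarMul]⟩
      · exact m2
    · rw [Set.mem_star] at hf
      rcases hf with hf | hf
      · refine ⟨-1, Or.inr rfl, 1, 1, ?_⟩
        rw [← star_star f, hf, star_planar_one]
        simp [planarMul]
      · rw [← star_star f, hf, star_coord]
        exact m2
  rw [eq_top_iff]
  intro f _
  have hf : f ∈ A.topologicalClosure := hA' ▸ StarSubalgebra.mem_top
  exact closure_mono hle hf

/-- The polynomials `legendreDeriv ℂ (n + j) (2 * n + j)`, which have degree `j`. -/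
def legendreDerivSequence (n : ℕ) : Polynomial.Sequence ℂ where
  elems' j := legendreDeriv ℂ (n + j) (n + j + n)
  degree_eq' j := degree_legendreDeriv (by lia)

/-- A sequence of polynomials with one member of each degree spans `ℂ[X]`; this is transported by
the linear map `q ↦ planarMul ε n q`. -/
theorem planarMul_mem_span (ε : ℂ) (n : ℕ) (q : ℂ[X]) :
    planarMul ε n q ∈ Submodule.span ℂ
      (Set.range fun j : ℕ => planarMul ε n (legendreDeriv ℂ (n + j) (n + j + n))) := by
  let T : ℂ[X] →ₗ[ℂ] C(S2, ℂ) :=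
    (LinearMap.mulLeft ℂ (planar ε ^ n)).comp (aeval (coord 2)).toLinearMap
  have hq : q ∈ Submodule.span ℂ (Set.range (legendreDerivSequence n)) := by
    rw [(legendreDerivSequence n).span fun j => by simp]
    exact Submodule.mem_top
  have := Submodule.mem_map_of_mem (f := T) hq
  rw [Submodule.map_span, ← Set.range_comp] at this
  exact this

/-! ### The spherical harmonics -/

/-- The sign `± 1` of `m`. -/
def indexSign (i : Index) : ℂ := if 0 ≤ (i.2 : ℤ) then 1 else -1

theorem indexSign_eq (i : Index) : indexSign i = 1 ∨ indexSign i = -1 := by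
  unfold indexSign
  split_ifs <;> simp

theorem indexSign_mul_natAbs (i : Index) :
    indexSign i * ((i.2 : ℤ).natAbs : ℂ) = ((i.2 : ℤ) : ℂ) := by
  have : ((i.2 : ℤ).natAbs : ℂ) = ((|(i.2 : ℤ)| : ℤ) : ℂ) := by
    rw [Int.abs_eq_natAbs, Int.cast_natCast]
  rw [this]
  unfold indexSign
  split_ifs with h
  · rw [abs_of_nonneg h, one_mul]
  · rw [abs_of_neg (not_le.1 h)]
    push_cast
    ring

/-- Spherical harmonics, not normalized. -/
def harmonic (i : Index) : C(S2, ℂ) :=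
  planarMul (indexSign i) (i.2 : ℤ).natAbs (legendreDeriv ℂ i.1 (i.1 + (i.2 : ℤ).natAbs))

theorem toLp_harmonic_mem_jointEigenspace (i : Index) :
    ContinuousMap.toLp 2 dS ℂ (harmonic i) ∈
      jointEigenspace ((i.2 : ℤ) : ℂ) ((i.1 : ℂ) * ((i.1 : ℂ) + 1)) := by
  rw [← indexSign_mul_natAbs]
  refine toLp_planarMul_legendreDeriv_mem_jointEigenspace ?_ _ _
  rcases indexSign_eq i with h | h <;> simp [h]

theorem toLp_harmonic_ne_zero (i : Index) : ContinuousMap.toLp 2 dS ℂ (harmonic i) ≠ 0 := by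
  rw [Ne, map_eq_zero_iff _ (ContinuousMap.toLp_injective (𝕜 := ℂ) dS)]
  refine planarMul_ne_zero (indexSign_eq i) _ (degree_ne_bot.1 ?_)
  have h := i.2.2
  rw [degree_legendreDeriv (d := i.1 - (i.2 : ℤ).natAbs) (by lia)]
  simp

theorem span_planarMonoid_le :
    Submodule.span ℂ (planarMonoid : Set C(S2, ℂ)) ≤ Submodule.span ℂ (Set.range harmonic) := by
  refine Submodule.span_le.2 ?_
  rintro _ ⟨ε, hε, n, q, rfl⟩
  refine Submodule.span_le.2 ?_ (planarMul_mem_span ε n q)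
  rintro _ ⟨j, rfl⟩
  refine Submodule.subset_span ?_
  rcases hε with rfl | rfl
  · refine ⟨⟨n + j, (n : ℤ), by lia, by lia⟩, ?_⟩
    simp [harmonic, indexSign]
  -- For `n = 0` both signs give the same function, and `indexSign` counts `m = 0` as positive.
  · rcases n with _ | n
    · refine ⟨⟨0 + j, (0 : ℤ), by lia, by lia⟩, ?_⟩
      simp [harmonic, indexSign, planarMul]
    · refine ⟨⟨n + 1 + j, -((n + 1 : ℕ) : ℤ), by lia, by lia⟩, ?_⟩
      have : ¬ 0 ≤ -((n + 1 : ℕ) : ℤ) := by lia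
      simp only [harmonic, indexSign, if_neg this, Int.natAbs_neg, Int.natAbs_natCast]

/-- The normalizing factor of a spherical harmonic. -/
def normFactor (i : Index) : ℝ := ‖ContinuousMap.toLp 2 dS ℂ (harmonic i)‖⁻¹

theorem normFactor_ne_zero (i : Index) : normFactor i ≠ 0 :=
  inv_ne_zero (norm_ne_zero_iff.2 (toLp_harmonic_ne_zero i))

/-- The spherical harmonics as elements of `L²(S²)`. -/
def harmonicLp (i : Index) : L2S := ContinuousMap.toLp 2 dS ℂ ((normFactor i : ℂ) • harmonic i)

theorem harmonicLp_mem_jointEigenspace (i : Index) :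
    harmonicLp i ∈ jointEigenspace ((i.2 : ℤ) : ℂ) ((i.1 : ℂ) * ((i.1 : ℂ) + 1)) := by
  rw [harmonicLp, map_smul]
  exact Submodule.smul_mem _ _ (toLp_harmonic_mem_jointEigenspace i)

theorem index_eq {i j : Index} (hm : ((j.2 : ℤ) : ℂ) = ((i.2 : ℤ) : ℂ))
    (hl : (j.1 : ℂ) * ((j.1 : ℂ) + 1) = (i.1 : ℂ) * ((i.1 : ℂ) + 1)) : j = i := by
  obtain ⟨l, m, hm₁⟩ := i
  obtain ⟨l', m', hm₂⟩ := j
  have hl' : l' * (l' + 1) = l * (l + 1) := by exact_mod_cast hl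
  obtain rfl : l' = l := by nlinarith
  obtain rfl : m' = m := by exact_mod_cast hm
  rfl

theorem eq_of_inner_harmonicLp_ne_zero {i : Index} {a b : ℂ} {ψ : L2S}
    (hψ : ψ ∈ jointEigenspace a b) (h : inner ℂ (harmonicLp i) ψ ≠ 0) :
    a = ((i.2 : ℤ) : ℂ) ∧ b = (i.1 : ℂ) * ((i.1 : ℂ) + 1) :=
  eq_of_inner_ne_zero_of_mem_jointEigenspace (by simp) (by simp)
    (harmonicLp_mem_jointEigenspace i) hψ h

theorem orthonormal_harmonicLp : Orthonormal ℂ harmonicLp := by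
  refine ⟨fun i => ?_, fun i j hij => ?_⟩
  · rw [harmonicLp, map_smul, norm_smul, normFactor, Complex.norm_real, norm_inv, norm_norm]
    exact inv_mul_cancel₀ (norm_ne_zero_iff.2 (toLp_harmonic_ne_zero i))
  · by_contra h
    obtain ⟨hm, hl⟩ := eq_of_inner_harmonicLp_ne_zero (harmonicLp_mem_jointEigenspace j) h
    exact hij (index_eq hm hl).symm

/-- Uniform density passes to `L²`, as `toLp` is continuous with dense range. -/
theorem topologicalClosure_span_harmonicLp :
    (Submodule.span ℂ (Set.range harmonicLp)).topologicalClosure = ⊤ := by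
  have hd : Dense (Submodule.span ℂ (Set.range harmonic) : Set C(S2, ℂ)) :=
    (Submodule.dense_iff_topologicalClosure_eq_top.2
      topologicalClosure_span_planarMonoid).mono span_planarMonoid_le
  have hd' := (ContinuousMap.toLp_denseRange ℂ dS ℂ (p := 2) (by simp)).dense_image
    (ContinuousMap.toLp 2 dS ℂ : C(S2, ℂ) →L[ℂ] L2S).continuous hd
  refine Submodule.dense_iff_topologicalClosure_eq_top.1 (hd'.mono ?_)
  rintro _ ⟨f, hf, rfl⟩
  have := Submodule.mem_map_of_mem
    (f := (ContinuousMap.toLp 2 dS ℂ : C(S2, ℂ) →L[ℂ] L2S).toLinearMap) hf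
  rw [Submodule.map_span, ← Set.range_comp] at this
  refine Submodule.span_le.2 ?_ this
  rintro _ ⟨i, rfl⟩
  have hi : ContinuousMap.toLp 2 dS ℂ (harmonic i) = (normFactor i : ℂ)⁻¹ • harmonicLp i := by
    rw [harmonicLp, map_smul, smul_smul,
      inv_mul_cancel₀ (Complex.ofReal_ne_zero.2 (normFactor_ne_zero i)), one_smul]
  change ContinuousMap.toLp 2 dS ℂ (harmonic i) ∈ _
  rw [hi]
  exact Submodule.smul_mem _ _ (Submodule.subset_span ⟨i, rfl⟩)

/-- The Hilbert basis of spherical harmonics. -/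
def harmonicBasis : HilbertBasis Index ℂ L2S :=
  HilbertBasis.mk orthonormal_harmonicLp topologicalClosure_span_harmonicLp.ge

theorem harmonicBasis_apply (i : Index) : harmonicBasis i = harmonicLp i := by
  rw [harmonicBasis, HilbertBasis.coe_mk]

theorem exists_inner_harmonicLp_ne_zero {ψ : L2S} (hψ : ψ ≠ 0) :
    ∃ i, inner ℂ (harmonicLp i) ψ ≠ 0 := by
  by_contra! h
  refine hψ (harmonicBasis.repr.map_eq_zero_iff.1 (lp.ext (funext fun i => ?_)))
  rw [HilbertBasis.repr_apply_apply, harmonicBasis_apply, h i]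
  rfl

theorem jointEigenspace_eq_span (i : Index) :
    jointEigenspace ((i.2 : ℤ) : ℂ) ((i.1 : ℂ) * ((i.1 : ℂ) + 1)) =
      Submodule.span ℂ {harmonicLp i} := by
  refine le_antisymm (fun ψ hψ => ?_) ?_
  · refine Submodule.mem_span_singleton.2 ⟨inner ℂ (harmonicLp i) ψ, ?_⟩
    by_contra hne
    -- The remainder after projecting onto `harmonicLp i` is a joint eigenvector for the same pair.
    -- If nonzero it would pair nontrivially with some `harmonicLp j`; the eigenvalues force `j =
    -- i`, to which it is orthogonal.
    obtain ⟨j, hj⟩ := exists_inner_harmonicLp_ne_zero (sub_ne_zero.2 (Ne.symm hne))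
    have hmem : ψ - inner ℂ (harmonicLp i) ψ • harmonicLp i ∈
        jointEigenspace ((i.2 : ℤ) : ℂ) ((i.1 : ℂ) * ((i.1 : ℂ) + 1)) :=
      Submodule.sub_mem _ hψ (Submodule.smul_mem _ _ (harmonicLp_mem_jointEigenspace i))
    obtain ⟨hm, hl⟩ := eq_of_inner_harmonicLp_ne_zero hmem hj
    obtain rfl := index_eq hm hl
    refine hj ?_
    rw [inner_sub_right, inner_smul_right, inner_self_eq_norm_sq_to_K,
      orthonormal_harmonicLp.1]
    simp
  · rw [Submodule.span_singleton_le_iff_mem]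
    exact harmonicLp_mem_jointEigenspace i

end SphericalHarmonics

end

open SphericalHarmonics in
theorem mainTheorem2 :
    ∃ (Y : Index → S2 → ℂ) (F : Index → ℝ → ℝ) (hY : ∀ i, MemLp (Y i) 2 dS)
      (B : HilbertBasis Index ℂ L2S),
      -- the functions `Y i` are smooth and form an orthonormal basis
      (∀ i, ContMDiff (𝓡 2) 𝓘(ℝ, ℂ) ∞ (Y i)) ∧
      (∀ i, B i = (hY i).toLp (Y i)) ∧
      -- they are common eigenfunctions: `H₃ Y = m Y` and `H² Y = l (l + 1) Y`
      (∀ i, ∃ h : B i ∈ (H 2).domain, H 2 ⟨B i, h⟩ = ((i.2 : ℤ) : ℂ) • B i) ∧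
      (∀ i, ∃ h : B i ∈ Hsq.domain, Hsq ⟨B i, h⟩ = ((i.1 : ℂ) * ((i.1 : ℂ) + 1)) • B i) ∧
      -- their form in spherical coordinates
      (∀ i, ∀ θ ∈ Set.Icc 0 Real.pi, ∀ φ : ℝ,
        Y i (sphPoint θ φ) =
          (F i θ : ℂ) * Complex.exp (Complex.I * ((i.2 : ℤ) : ℂ) * (φ : ℂ))) ∧
      -- every joint eigenspace is one-dimensional, and there are no further ones
      (∀ i : Index, Module.finrank ℂ
        (jointEigenspace ((i.2 : ℤ) : ℂ) ((i.1 : ℂ) * ((i.1 : ℂ) + 1))) = 1) ∧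
      (∀ a b : ℂ, jointEigenspace a b ≠ ⊥ →
        ∃ i : Index, a = ((i.2 : ℤ) : ℂ) ∧ b = (i.1 : ℂ) * ((i.1 : ℂ) + 1)) := by
  refine ⟨fun i => ((normFactor i : ℂ) • harmonic i : C(S2, ℂ)), fun i θ => normFactor i *
    (Real.sin θ ^ (i.2 : ℤ).natAbs *
      (legendreDeriv ℝ i.1 (i.1 + (i.2 : ℤ).natAbs)).eval (Real.cos θ)),
    fun i => ContinuousMap.memLp dS ℂ _, harmonicBasis, ?_, ?_, ?_, ?_, ?_, ?_, ?_⟩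
  · intro i
    exact (ContinuousLinearMap.mul ℝ ℂ (normFactor i)).contMDiff.comp (contMDiff_planarMul _ _ _)
  · intro i
    rw [harmonicBasis_apply]
    rfl
  · intro i
    rw [harmonicBasis_apply]
    exact (harmonicLp_mem_jointEigenspace i).1
  · intro i
    rw [harmonicBasis_apply]
    exact (harmonicLp_mem_jointEigenspace i).2
  · intro i θ _ φ
    have h := planarMul_sphPoint (indexSign_eq i) (i.2 : ℤ).natAbs
      (legendreDeriv ℂ i.1 (i.1 + (i.2 : ℤ).natAbs)) θ φ
    -- The value at the real point `cos θ` is that of the real polynomial.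
    rw [indexSign_mul_natAbs, ← map_legendreDeriv Complex.ofRealHom,
      ← Complex.ofRealHom_eq_coe (Real.cos θ), Polynomial.eval_map_apply] at h
    change (normFactor i : ℂ) * planarMul _ _ _ _ = _
    rw [← map_legendreDeriv Complex.ofRealHom, h]
    simp
    ring
  · intro i
    rw [jointEigenspace_eq_span]
    exact finrank_span_singleton (orthonormal_harmonicLp.ne_zero i)
  · intro a b hab
    obtain ⟨ψ, hψ, hne⟩ := Submodule.exists_mem_ne_zero_of_ne_bot hab
    obtain ⟨i, hi⟩ := exists_inner_harmonicLp_ne_zero hne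
    exact ⟨i, eq_of_inner_harmonicLp_ne_zero hψ hi⟩
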